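/- Let $n\ge 0$ and let $D=(D_1,\dots,D_n)$ be a diagram, i.e. a list of $n$ subsets $D_j\subseteq[n]=\{1,\dots,n\}$. For $R,S\subseteq[n]$ write $R\le S$ if $\#R=\#S$ and, for each $k$, the $k$-th least element of $R$ is at most the $k$-th least element of $S$. Let $Y$ be the $n\times n$ upper-triangular matrix with indeterminates $y_{ij}$ in the positions $i\le j$ and zeros elsewhere, and for $R,S\subseteq[n]$ let $Y_R^S$ be its submatrix with rows $S$ and columns $R$. The group $B\subset GL(n,\mathbb C)$ of invertible upper-triangular matrices acts on $\mathbb C[Y]=\mathbb C[y_{ij}: i\le j]$ by $g\cdot f(Y)=f(g^{-1}Y)$; the flagged Weyl module of $D$ is the $B$-module $$M_D=\mathrm{Span}_{\mathbb C}\Bigl\{\prod_{j=1}^n\det\bigl(Y_{D_j}^{C_j}\bigr): C_j\le D_j\text{ for all }j\Bigr\}\subseteq\mathbb C[Y],$$ and its dual character is $\chi_D(x_1,\dots,x_n)=\mathrm{tr}\bigl(\mathrm{diag}(x_1,\dots,x_n): M_D^*\to M_D^*\bigr)$ for $x_1,\dots,x_n\in\mathbb C^\times$. For $S\subseteq[n]$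 let $SM_n(S)$ be the Schubert matroid on $[n]$, whose bases are the sets $R\le S$. For a matroid $M$ on $[n]$ with rank function $r_M$ let $$P(M)=\Bigl\{t\in\mathbb R^n:\ \sum_{i\in I}t_i\le r_M(I)\text{ for all } I\subsetneq[n],\ \sum_{i=1}^n t_i=r_M([n])\Bigr\}$$ be its matroid polytope. The Newton polytope $\mathrm{Newton}(f)\subseteq\mathbb R^n$ of a polynomial $f$ is the convex hull of its support, the set of exponent vectors of the monomials with nonzero coefficient in $f$. A generalized permutahedron is a polytope obtained from the standard permutahedron (whose vertices are the permutations of $(0,1,\dots,n-1)$) by moving its vertices so that all edge directions and orientations are preserved, where edges may degenerate to points. Theorem. The dual character $\chi_D$ is given by a unique polynomial in $x_1,\dots,x_n$. It has saturated Newton polytope (SNP): every lattice point of $\mathrm{Newton}(\chi_D)$ lies in the support of $\chi_D$; moreover all nonzero coefficients of $\chi_D$ are positive integers. Its Newton polytope is the Minkowski sum $$\mathrm{Newton}(\chi_D)=\sum_{j=1}^n P(SM_n(D_j)).$$ In particular, $\mathrm{Newton}(\chi_D)$ is a generalized permutahedron. -/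

import Mathlib

open scoped Pointwise

noncomputable section

namespace FlaggedWeyl

variable {n : ℕ}

/-! ### The componentwise order on subsets of `[n]` and Schubert matroids -/

/-- `R ≤ S`: the sets have the same size and, for each `k`, the `k`-th least element of `R`
does not exceed the `k`-th least element of `S`. -/
def GaleLE (R S : Finset (Fin n)) : Prop :=
  ∃ h : R.card = S.card, ∀ k : Fin S.card, R.orderEmbOfFin h k ≤ S.orderEmbOfFin rfl k

theorem card_filter_le_eq (R : Finset (Fin n)) {r : ℕ} (h : R.card = r) (m : Fin n) :
    (R.filter (· ≤ m)).card =
      (Finset.univ.filter fun k : Fin r => R.orderEmbOfFin h k ≤ m).card := by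
  rw [← Finset.card_map (R.orderEmbOfFin h).toEmbedding]
  congr 1
  ext x
  simp only [Finset.mem_filter, Finset.mem_map, Finset.mem_univ, true_and,
    RelEmbedding.coe_toEmbedding]
  constructor
  · rintro ⟨hx, hm⟩
    have : x ∈ Set.range (R.orderEmbOfFin h) := by
      rw [Finset.range_orderEmbOfFin]; exact hx
    obtain ⟨k, rfl⟩ := this
    exact ⟨k, hm, rfl⟩
  · rintro ⟨k, hk, rfl⟩
    exact ⟨Finset.orderEmbOfFin_mem R h k, hk⟩

theorem galeLE_iff (R S : Finset (Fin n)) :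
    GaleLE R S ↔ R.card = S.card ∧
      ∀ m : Fin n, (S.filter (· ≤ m)).card ≤ (R.filter (· ≤ m)).card := by
  constructor
  · rintro ⟨h, hk⟩
    refine ⟨h, fun m => ?_⟩
    rw [card_filter_le_eq R h, card_filter_le_eq S rfl]
    apply Finset.card_le_card
    intro k
    simp only [Finset.mem_filter, Finset.mem_univ, true_and]
    exact fun hm => (hk k).trans hm
  · rintro ⟨h, hm⟩
    refine ⟨h, fun k => ?_⟩
    by_contra hlt
    rw [not_le] at hlt
    have h1 := hm (S.orderEmbOfFin rfl k)
    rw [card_filter_le_eq R h, card_filter_le_eq S rfl] at h1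
    have h2 : (Finset.Iic k).card ≤ (Finset.univ.filter fun i : Fin S.card =>
        S.orderEmbOfFin rfl i ≤ S.orderEmbOfFin rfl k).card := by
      apply Finset.card_le_card
      intro i
      simp
    have h3 : (Finset.univ.filter fun i : Fin S.card =>
        R.orderEmbOfFin h i ≤ S.orderEmbOfFin rfl k).card ≤ (Finset.Iio k).card := by
      apply Finset.card_le_card
      intro i
      simp only [Finset.mem_filter, Finset.mem_univ, true_and, Finset.mem_Iio]
      intro hi
      exact (R.orderEmbOfFin h).lt_iff_lt.1 (hi.trans_lt hlt)
    rw [Fin.card_Iic] at h2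
    rw [Fin.card_Iio] at h3
    omega

theorem galeLE_refl (S : Finset (Fin n)) : GaleLE S S :=
  ⟨rfl, fun _ => le_rfl⟩

theorem galeLE_exchange (S A B : Finset (Fin n)) (hA : GaleLE A S) (hB : GaleLE B S)
    (a : Fin n) (ha : a ∈ A) (haB : a ∉ B) :
    ∃ b ∈ B, b ∉ A ∧ GaleLE (insert b (A.erase a)) S := by
  rw [galeLE_iff] at hA hB
  obtain ⟨hAc, hA⟩ := hA
  obtain ⟨hBc, hB⟩ := hB
  have hne : (B \ A).Nonempty := by
    rw [Finset.sdiff_nonempty]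
    intro hsub
    exact haB (Finset.eq_of_subset_of_card_le hsub (by omega) ▸ ha)
  set b := (B \ A).min' hne with hb
  have hbm : b ∈ B \ A := Finset.min'_mem _ _
  rw [Finset.mem_sdiff] at hbm
  have hmin : ∀ c ∈ B, c ∉ A → b ≤ c := fun c hc hcA =>
    Finset.min'_le _ _ (Finset.mem_sdiff.2 ⟨hc, hcA⟩)
  have hbe : b ∉ A.erase a := fun h => hbm.2 (Finset.mem_of_mem_erase h)
  refine ⟨b, hbm.1, hbm.2, ?_⟩
  rw [galeLE_iff]
  refine ⟨?_, fun m => ?_⟩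
  · rw [Finset.card_insert_of_notMem hbe, Finset.card_erase_add_one ha, hAc]
  · rw [Finset.filter_insert, Finset.filter_erase]
    by_cases hbmle : b ≤ m
    · rw [if_pos hbmle, Finset.card_insert_of_notMem (fun h => hbm.2
        (Finset.mem_filter.1 (Finset.mem_of_mem_erase h)).1)]
      have := Finset.pred_card_le_card_erase (s := A.filter (· ≤ m)) (a := a)
      have := hA m
      omega
    · rw [if_neg hbmle]
      refine (hB m).trans (Finset.card_le_card fun c hc => ?_)
      rw [Finset.mem_filter] at hc
      rw [Finset.mem_erase, Finset.mem_filter]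
      refine ⟨fun h => haB (h ▸ hc.1), ?_, hc.2⟩
      by_contra hcA
      exact hbmle ((hmin c hc.1 hcA).trans hc.2)

/-- The Schubert matroid `SM_n(S)` on the ground set `[n]`: its bases are the sets `R ≤ S`. -/
def schubertMatroid (S : Finset (Fin n)) : Matroid (Fin n) :=
  Matroid.ofIsBaseOfFinite (E := Set.univ) Set.finite_univ
    (fun B => ∃ R : Finset (Fin n), (R : Set (Fin n)) = B ∧ GaleLE R S)
    ⟨S, S, rfl, galeLE_refl S⟩
    (by
      rintro _ _ ⟨A, rfl, hA⟩ ⟨B, rfl, hB⟩ a ⟨ha, haB⟩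
      obtain ⟨b, hb, hbA, h⟩ := galeLE_exchange S A B hA hB a (by simpa using ha)
        (by simpa using haB)
      exact ⟨b, ⟨by simpa using hb, by simpa using hbA⟩, insert b (A.erase a), by simp, h⟩)
    (fun _ _ => Set.subset_univ _)

/-- The matroid polytope `P(M)` of a matroid `M` on `[n]` with rank function `r`:
all `t ∈ ℝⁿ` with `∑_{i ∈ I} t_i ≤ r(I)` for `I ≠ [n]` and `∑_i t_i = r([n])`. -/
def matroidPolytope (M : Matroid (Fin n)) : Set (Fin n → ℝ) :=
  {t | (∀ I : Finset (Fin n), I ≠ Finset.univ → ∑ i ∈ I, t i ≤ ((M.eRk I).toNat : ℝ)) ∧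
    ∑ i, t i = ((M.eRk Set.univ).toNat : ℝ)}

/-! ### Newton polytopes and generalized permutahedra -/

/-- The support of a polynomial, as a set of points of `ℝⁿ`. -/
def supportPoints (f : MvPolynomial (Fin n) ℂ) : Set (Fin n → ℝ) :=
  {p | ∃ m ∈ f.support, p = fun i => (m i : ℝ)}

/-- The Newton polytope: the convex hull of the support. -/
def newtonPolytope (f : MvPolynomial (Fin n) ℂ) : Set (Fin n → ℝ) :=
  convexHull ℝ (supportPoints f)

/-- Saturated Newton polytope: every lattice point of the Newton polytope is in the support. -/
def HasSNP (f : MvPolynomial (Fin n) ℂ) : Prop :=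
  ∀ p : Fin n → ℤ, (fun i => (p i : ℝ)) ∈ newtonPolytope f →
    (fun i => (p i : ℝ)) ∈ supportPoints f

/-- The vertex `(π(1), …, π(n))` (entries `0, …, n - 1`) of the standard permutahedron. -/
def permVertex (π : Equiv.Perm (Fin n)) : Fin n → ℝ :=
  fun i => ((π i : ℕ) : ℝ)

/-- A generalized permutahedron: a polytope obtained from the standard permutahedron by moving
its vertices so that all edge directions and orientations are preserved, where edges may
degenerate to points. The edges of the standard permutahedron join the vertices of `π` and
`(k l) ∘ π` for consecutive values `k`, `l = k + 1`. -/
def IsGeneralizedPermutahedron (P : Set (Fin n → ℝ)) : Prop :=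
  ∃ v : Equiv.Perm (Fin n) → (Fin n → ℝ),
    P = convexHull ℝ (Set.range v) ∧
    ∀ (π : Equiv.Perm (Fin n)) (k l : Fin n), (l : ℕ) = (k : ℕ) + 1 →
      ∃ c : ℝ, 0 ≤ c ∧
        v (Equiv.swap k l * π) - v π = c • (permVertex (Equiv.swap k l * π) - permVertex π)

/-! ### The Borel subgroup, its representations and their characters -/

/-- The subgroup `B` of upper-triangular matrices in `GL(n, ℂ)`. -/
def borel (n : ℕ) : Subgroup (GL (Fin n) ℂ) where
  carrier := {g | ∀ i j : Fin n, j < i → (g : Matrix (Fin n) (Fin n) ℂ) i j = 0}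
  one_mem' := fun i j h => by simp [h.ne']
  mul_mem' := by
    intro a b ha hb
    have : ((a : Matrix (Fin n) (Fin n) ℂ) * b).BlockTriangular id :=
      Matrix.BlockTriangular.mul (fun i j h => ha i j h) (fun i j h => hb i j h)
    exact fun i j h => by simpa using this h
  inv_mem' := by
    intro a ha
    have : ((a : Matrix (Fin n) (Fin n) ℂ)⁻¹).BlockTriangular id := by
      have : Invertible (a : Matrix (Fin n) (Fin n) ℂ) := a.invertible
      exact Matrix.blockTriangular_inv_of_blockTriangular (fun i j h => ha i j h)
    exact fun i j h => by simpa using this h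

/-- The diagonal matrix `diag(x_1, …, x_n)` as an element of `B`. -/
def torus (x : Fin n → ℂˣ) : borel n :=
  ⟨⟨Matrix.diagonal fun i => (x i : ℂ), Matrix.diagonal fun i => ((x i)⁻¹ : ℂˣ),
    by simp [Matrix.diagonal_mul_diagonal], by simp [Matrix.diagonal_mul_diagonal]⟩,
    fun i j h => by simp [h.ne']⟩

/-- The character of a `B`-module: the trace of `diag(x_1, …, x_n)`. -/
def character {N : Type*} [AddCommGroup N] [Module ℂ N] (ρ : Representation ℂ (borel n) N)
    (x : Fin n → ℂˣ) : ℂ :=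
  LinearMap.trace ℂ N (ρ (torus x))

/-- The dual character of a `B`-module: the character of the dual module. -/
def dualCharacter {N : Type*} [AddCommGroup N] [Module ℂ N] (ρ : Representation ℂ (borel n) N)
    (x : Fin n → ℂˣ) : ℂ :=
  character ρ.dual x

/-! ### The flagged Weyl module -/

/-- The polynomial ring `ℂ[Y]` in the indeterminates `y_{ij}`, `i ≤ j`. -/
abbrev CoordRing (n : ℕ) : Type :=
  MvPolynomial {p : Fin n × Fin n // p.1 ≤ p.2} ℂ

/-- The upper-triangular matrix `Y` of indeterminates. -/
def genericUpper (n : ℕ) : Matrix (Fin n) (Fin n) (CoordRing n) :=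
  Matrix.of fun i j => if h : i ≤ j then MvPolynomial.X ⟨(i, j), h⟩ else 0

/-- The matrix `g⁻¹ Y`. -/
def invMulGeneric (g : borel n) : Matrix (Fin n) (Fin n) (CoordRing n) :=
  ((g⁻¹ : borel n) : GL (Fin n) ℂ).val.map MvPolynomial.C * genericUpper n

/-- The substitution `f(Y) ↦ f(g⁻¹ Y)` on `ℂ[Y]`. -/
def translate (g : borel n) : CoordRing n →ₐ[ℂ] CoordRing n :=
  MvPolynomial.aeval fun p => invMulGeneric g p.1.1 p.1.2

theorem invMulGeneric_eq_zero (g : borel n) {i j : Fin n} (h : j < i) :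
    invMulGeneric g i j = 0 := by
  rw [invMulGeneric, Matrix.mul_apply]
  refine Finset.sum_eq_zero fun k _ => ?_
  by_cases hk : k < i
  · have := (g⁻¹ : borel n).2 i k hk
    rw [Matrix.map_apply]
    erw [this]
    simp
  · have : ¬ k ≤ j := fun hkj => hk (hkj.trans_lt h)
    simp [genericUpper, this]

theorem translate_genericUpper (g : borel n) (i j : Fin n) :
    translate g (genericUpper n i j) = invMulGeneric g i j := by
  by_cases h : i ≤ j
  · simp [genericUpper, h, translate]
  · rw [invMulGeneric_eq_zero g (not_le.1 h)]
    simp [genericUpper, h]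

/-- The action of `B` on `ℂ[Y]`, where `g` sends `f(Y)` to `f(g⁻¹ Y)`. -/
def coordRep (n : ℕ) : Representation ℂ (borel n) (CoordRing n) where
  toFun g := (translate g).toLinearMap
  map_one' := by
    have : translate (1 : borel n) = AlgHom.id ℂ (CoordRing n) := by
      apply MvPolynomial.algHom_ext
      rintro ⟨⟨i, j⟩, h⟩
      have h' : i ≤ j := h
      have e : (((1 : borel n)⁻¹ : borel n) : GL (Fin n) ℂ).val.map
          (MvPolynomial.C : ℂ →+* CoordRing n) = 1 := by
        rw [inv_one]
        exact Matrix.map_one _ (map_zero _) (map_one _)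
      simp only [translate, MvPolynomial.aeval_X, AlgHom.coe_id, id_eq]
      rw [invMulGeneric, e, one_mul]
      simp [genericUpper, h']
    rw [this]; rfl
  map_mul' g h := by
    have : translate (g * h) = (translate g).comp (translate h) := by
      apply MvPolynomial.algHom_ext
      rintro ⟨⟨i, j⟩, hij⟩
      have e : (translate h) (MvPolynomial.X ⟨(i, j), hij⟩) = invMulGeneric h i j := by
        simp [translate]
      have e' : (translate (g * h)) (MvPolynomial.X ⟨(i, j), hij⟩) =
          invMulGeneric (g * h) i j := by
        simp [translate]
      rw [AlgHom.comp_apply, e, e']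
      have e2 : invMulGeneric (g * h) =
          ((h⁻¹ : borel n) : GL (Fin n) ℂ).val.map MvPolynomial.C * invMulGeneric g := by
        rw [invMulGeneric, invMulGeneric, ← Matrix.mul_assoc, ← Matrix.map_mul, mul_inv_rev]
        rfl
      rw [e2]
      conv_rhs => rw [invMulGeneric]
      rw [Matrix.mul_apply, Matrix.mul_apply, map_sum]
      refine Finset.sum_congr rfl fun k _ => ?_
      rw [map_mul, translate_genericUpper, Matrix.map_apply, ← MvPolynomial.algebraMap_eq,
        AlgHom.commutes]
    rw [this]; rfl

/-- The minor of `Y` with rows `S` and columns `R`. -/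
def minor (R S : Finset (Fin n)) (h : S.card = R.card) : CoordRing n :=
  ((genericUpper n).submatrix (S.orderEmbOfFin h) (R.orderEmbOfFin rfl)).det

/-- The subspace `M_D` of `ℂ[Y]` spanned by the products of minors `∏_j det(Y_{D_j}^{C_j})`
over all `C ≤ D`. -/
def weylSubmodule (D : Fin n → Finset (Fin n)) : Submodule ℂ (CoordRing n) :=
  Submodule.span ℂ
    {f | ∃ (C : Fin n → Finset (Fin n)) (h : ∀ j, GaleLE (C j) (D j)),
      f = ∏ j, minor (D j) (C j) (h j).fst}

/-- The span of the minors of `Y` with columns `R` and rows `S ≤ R`. -/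
def minorSpan (R : Finset (Fin n)) : Submodule ℂ (CoordRing n) :=
  Submodule.span ℂ {f | ∃ (S : Finset (Fin n)) (h : GaleLE S R), f = minor R S h.fst}

theorem weylSubmodule_eq_prod (D : Fin n → Finset (Fin n)) :
    weylSubmodule D = ∏ j, minorSpan (D j) := by
  unfold minorSpan
  rw [Submodule.prod_span, weylSubmodule]
  congr 1
  ext f
  rw [Set.mem_fintype_prod, Set.mem_ofPred_eq]
  constructor
  · rintro ⟨C, h, rfl⟩
    exact ⟨fun j => minor (D j) (C j) (h j).fst, fun j => ⟨C j, h j, rfl⟩, rfl⟩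
  · rintro ⟨g, hg, rfl⟩
    choose C h e using hg
    exact ⟨C, h, Finset.prod_congr rfl fun j _ => e j⟩

theorem det_rows_mem_minorSpan (R : Finset (Fin n)) (f : Fin R.card → Fin n) :
    ((genericUpper n).submatrix f (R.orderEmbOfFin rfl)).det ∈ minorSpan R := by
  classical
  by_cases h0 : ((genericUpper n).submatrix f (R.orderEmbOfFin rfl)).det = 0
  · rw [h0]; exact Submodule.zero_mem _
  have hinj : Function.Injective f := by
    intro a b hab
    by_contra hne
    refine h0 (Matrix.det_zero_of_row_eq hne ?_)
    ext k
    simp [hab]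
  have hcard : (Finset.univ.image f).card = R.card := by
    rw [Finset.card_image_of_injective _ hinj, Finset.card_univ, Fintype.card_fin]
  obtain ⟨σ, hσ⟩ : ∃ σ : Equiv.Perm (Fin R.card),
      ∀ k, f (σ k) ≤ R.orderEmbOfFin rfl k := by
    by_contra hno
    push Not at hno
    refine h0 ?_
    rw [Matrix.det_apply]
    refine Finset.sum_eq_zero fun σ _ => ?_
    obtain ⟨k, hk⟩ := hno σ
    rw [Finset.prod_eq_zero (Finset.mem_univ k), smul_zero]
    simp [genericUpper, not_le.2 hk]
  have hle : GaleLE (Finset.univ.image f) R := by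
    rw [galeLE_iff]
    refine ⟨hcard, fun m => ?_⟩
    rw [card_filter_le_eq R rfl]
    refine Finset.card_le_card_of_injOn (fun k => f (σ k)) ?_ ?_
    · intro k hk
      simp only [Finset.coe_filter, Finset.mem_univ, true_and, Set.mem_ofPred_eq] at hk
      simp only [Finset.coe_filter, Set.mem_ofPred_eq]
      exact ⟨Finset.mem_image_of_mem _ (Finset.mem_univ _), (hσ k).trans hk⟩
    · exact (hinj.comp σ.injective).injOn
  have hmem : ∀ k, ∃ l, (Finset.univ.image f).orderEmbOfFin hcard l = f k := by
    intro k
    have : f k ∈ Set.range ((Finset.univ.image f).orderEmbOfFin hcard) := by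
      rw [Finset.range_orderEmbOfFin]; simp
    exact this
  choose τ hτ using hmem
  have hτinj : Function.Injective τ := fun a b hab => hinj (by rw [← hτ, ← hτ, hab])
  let τ' : Equiv.Perm (Fin R.card) :=
    Equiv.ofBijective τ (Finite.injective_iff_bijective.1 hτinj)
  have e : (genericUpper n).submatrix f (R.orderEmbOfFin rfl) =
      ((genericUpper n).submatrix ((Finset.univ.image f).orderEmbOfFin hcard)
        (R.orderEmbOfFin rfl)).submatrix τ' id := by
    ext1 a b
    simp [τ', hτ]
  rw [e, Matrix.det_permute]
  have hm : minor R (Finset.univ.image f) hle.fst ∈ minorSpan R :=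
    Submodule.subset_span ⟨_, hle, rfl⟩
  have hm2 := (minorSpan R).smul_mem (((Equiv.Perm.sign τ' : ℤˣ) : ℤ) : ℂ) hm
  convert hm2 using 1
  rw [MvPolynomial.smul_eq_C_mul]
  simp [minor]

theorem translate_minor_mem (g : borel n) (R S : Finset (Fin n)) (h : S.card = R.card) :
    translate g (minor R S h) ∈ minorSpan R := by
  classical
  set A : Matrix (Fin n) (Fin n) ℂ := ((g⁻¹ : borel n) : GL (Fin n) ℂ).val with hA
  have e : translate g (minor R S h) =
      (Matrix.of fun k => ∑ i, (MvPolynomial.C (A (S.orderEmbOfFin h k) i) : CoordRing n) •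
        fun l => genericUpper n i (R.orderEmbOfFin rfl l)).det := by
    rw [minor, AlgHom.map_det]
    congr 1
    ext1 k l
    rw [AlgHom.mapMatrix_apply, Matrix.map_apply, Matrix.submatrix_apply,
      translate_genericUpper, invMulGeneric, Matrix.mul_apply]
    simp [hA]
  rw [e]
  have e2 := (Matrix.detRowAlternating (n := Fin R.card)
    (R := CoordRing n)).toMultilinearMap.map_sum
    (fun k i => (MvPolynomial.C (A (S.orderEmbOfFin h k) i) : CoordRing n) •
        fun l => genericUpper n i (R.orderEmbOfFin rfl l))
  refine (congrArg (· ∈ minorSpan R) e2).mpr ?_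
  refine Submodule.sum_mem _ fun f _ => ?_
  rw [MultilinearMap.map_smul_univ, ← map_prod, smul_eq_mul, ← MvPolynomial.smul_eq_C_mul]
  exact Submodule.smul_mem _ _ (det_rows_mem_minorSpan R f)

theorem translate_mem_weylSubmodule (D : Fin n → Finset (Fin n)) (g : borel n)
    {f : CoordRing n} (hf : f ∈ weylSubmodule D) : translate g f ∈ weylSubmodule D := by
  suffices h : weylSubmodule D ≤ (weylSubmodule D).comap (translate g).toLinearMap from h hf
  conv_lhs => rw [weylSubmodule]
  rw [Submodule.span_le]
  rintro _ ⟨C, h, rfl⟩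
  change translate g _ ∈ weylSubmodule D
  rw [weylSubmodule_eq_prod, map_prod]
  generalize (Finset.univ : Finset (Fin n)) = s
  classical
  induction s using Finset.induction_on with
  | empty => simpa using ⟨1, map_one _⟩
  | insert a s ha ih =>
    rw [Finset.prod_insert ha, Finset.prod_insert ha]
    exact Submodule.mul_mem_mul (translate_minor_mem g _ _ _) ih

/-- The flagged Weyl module `M_D` as a subrepresentation of `ℂ[Y]`. -/
def weylSubrep (D : Fin n → Finset (Fin n)) : Subrepresentation (coordRep n) where
  toSubmodule := weylSubmodule D
  apply_mem_toSubmodule g _ hv := translate_mem_weylSubmodule D g hv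

/-- The flagged Weyl module `M_D` as a representation of `B`. -/
def weylModule (D : Fin n → Finset (Fin n)) :
    Representation ℂ (borel n) (weylSubrep D).toSubmodule :=
  (weylSubrep D).toRepresentation

/-- The polynomial `χ` is the dual character of `M_D`: it agrees with
`char*(M_D)(x_1, …, x_n)` for all nonzero `x_1, …, x_n`. -/
def IsDualCharacter (D : Fin n → Finset (Fin n)) (χ : MvPolynomial (Fin n) ℂ) : Prop :=
  ∀ x : Fin n → ℂˣ,
    MvPolynomial.eval (fun i => (x i : ℂ)) χ = dualCharacter (weylModule D) x

end FlaggedWeyl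

end

/-!
The products of minors spanning `M_D` are nonzero weight vectors for the torus: the product indexed
by `C` has weight the monomial with exponent vector `∑_j 1_{C_j}`. Hence the coefficients of `χ_D`
count the elements of each weight in a basis of such products, and its exponent vectors are the
sums of indicator vectors of bases `C_j` of the Schubert matroids.

The indicator vectors of the bases of a matroid are the lattice points of the base polytope of its
rank function. Base polytopes of submodular functions are additive, `P(f + g) = P(f) + P(g)`, and
the coordinates of a decomposition can be chosen one at a time: submodularity leaves a nonempty
interval for each, and the constraints on the remaining coordinates are again submodular. This
uses only the order of the scalars, so it works over `ℤ` as well as over `ℝ`. Over `ℤ` it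
identifies the support of `χ_D` with all the lattice points of `P(∑_j r_j)`, over `ℝ` it gives the
Minkowski sum.

The greedy algorithm provides the vertices of a base polytope. Exchanging two elements that are
consecutive in the greedy order moves the vertex by the defect of submodularity, which is
nonnegative, along the corresponding edge of the permutahedron.
-/

noncomputable section

namespace FlaggedWeyl

section Submodular

variable {α R : Type*} [DecidableEq α]

/-- Submodularity of a set function on the finite subsets of a type. -/
def IsSubmodular [Add R] [LE R] (f : Finset α → R) : Prop :=
  ∀ I J, f (I ∪ J) + f (I ∩ J) ≤ f I + f J

theorem isSubmodular_sum {ι : Type*} [AddCommMonoid R] [PartialOrder R] [IsOrderedAddMonoid R]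
    {s : Finset ι} {f : ι → Finset α → R} (hf : ∀ j ∈ s, IsSubmodular (f j)) :
    IsSubmodular (∑ j ∈ s, f j) := fun I J => by
  simpa only [Finset.sum_apply, Finset.sum_add_distrib] using
    Finset.sum_le_sum fun j hj => hf j hj I J

theorem IsSubmodular.intCast [Ring R] [PartialOrder R] [IsOrderedRing R]
    {f : Finset α → ℤ} (hf : IsSubmodular f) : IsSubmodular fun I => (f I : R) := fun I J => by
  simpa only [Int.cast_add] using Int.cast_mono (R := R) (hf I J)

/-- The set function whose inequalities `∑_{i ∈ I} t i ≤ fixCoord e a f I`, for `e ∉ I`, say that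
`t` extended by `t e = a` satisfies the inequalities of `f`. -/
def fixCoord [Sub R] [Min R] (e : α) (a : R) (f : Finset α → R) : Finset α → R :=
  fun I => min (f (I.erase e)) (f (insert e I) - a)

theorem fixCoord_of_notMem [Sub R] [Min R] {e : α} {I : Finset α} (he : e ∉ I) (a : R)
    (f : Finset α → R) : fixCoord e a f I = min (f I) (f (insert e I) - a) := by
  rw [fixCoord, Finset.erase_eq_of_notMem he]

variable [AddCommGroup R] [LinearOrder R] [IsOrderedAddMonoid R]

theorem isSubmodular_fixCoord {f : Finset α → R} (hf : IsSubmodular f) (e : α) (a : R) :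
    IsSubmodular (fixCoord e a f) := by
  intro I J
  have h₁ := hf (I.erase e) (J.erase e)
  have h₂ := hf (I.erase e) (insert e J)
  have h₃ := hf (insert e I) (J.erase e)
  have h₄ := hf (insert e I) (insert e J)
  rw [← Finset.erase_union_distrib, show I.erase e ∩ J.erase e = (I ∩ J).erase e by grind] at h₁
  rw [show I.erase e ∪ insert e J = insert e (I ∪ J) by grind,
    show I.erase e ∩ insert e J = (I ∩ J).erase e by grind] at h₂
  rw [show insert e I ∪ J.erase e = insert e (I ∪ J) by grind,
    show insert e I ∩ J.erase e = (I ∩ J).erase e by grind] at h₃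
  rw [← Finset.insert_union_distrib, ← Finset.insert_inter_distrib] at h₄
  simp only [fixCoord]
  grind

theorem IsSubmodular.exists_coord_between {f g : Finset α → R} (hf : IsSubmodular f)
    (hg : IsSubmodular g) {e : α} {s : Finset α} (he : e ∉ s) {p : α → R}
    (hp : ∀ I ⊆ insert e s, ∑ i ∈ I, p i ≤ f I + g I) :
    ∃ a, ∀ I ⊆ s, ∑ i ∈ insert e I, p i - f I - g (insert e I) ≤ a ∧
      a ≤ f (insert e I) + g I - ∑ i ∈ I, p i := by
  obtain ⟨J, hJ, hmax⟩ := s.powerset.exists_max_image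
    (fun I => ∑ i ∈ insert e I, p i - f I - g (insert e I)) (Finset.powerset_nonempty s)
  refine ⟨_, fun I hI => ⟨hmax I (Finset.mem_powerset.2 hI), ?_⟩⟩
  rw [Finset.mem_powerset] at hJ
  have hunion := hp (insert e (I ∪ J)) (by grind)
  have hinter := hp (I ∩ J) (by grind)
  have hfIJ := hf (insert e I) J
  have hgIJ := hg I (insert e J)
  have hpIJ := Finset.sum_union_inter (s₁ := I) (s₂ := insert e J) (f := p)
  rw [Finset.insert_union, Finset.insert_inter_of_notMem (by grind)] at hfIJ
  rw [Finset.union_insert, Finset.inter_insert_of_notMem (by grind)] at hgIJ hpIJ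
  grind

theorem IsSubmodular.exists_sum_le_and_sum_sub_le {f g : Finset α → R} (hf : IsSubmodular f)
    (hg : IsSubmodular g) (hf₀ : f ∅ = 0) (hg₀ : g ∅ = 0) (s : Finset α) {p : α → R}
    (hp : ∀ I ⊆ s, ∑ i ∈ I, p i ≤ f I + g I) :
    ∃ q : α → R, ∀ I ⊆ s, ∑ i ∈ I, q i ≤ f I ∧ ∑ i ∈ I, (p i - q i) ≤ g I := by
  induction s using Finset.induction_on generalizing f g with
  | empty => exact ⟨0, by simp [hf₀, hg₀]⟩
  | insert e s he ih =>
    obtain ⟨a, ha⟩ := hf.exists_coord_between hg he hp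
    have notMem {I : Finset α} (hI : I ⊆ s) : e ∉ I := fun h => he (hI h)
    have ha₀ := ha ∅ (Finset.empty_subset s)
    simp only [insert_empty_eq, Finset.sum_singleton, Finset.sum_empty, hf₀, hg₀] at ha₀
    obtain ⟨q, hq⟩ := ih (isSubmodular_fixCoord hf e a) (isSubmodular_fixCoord hg e (p e - a))
      (by rw [fixCoord_of_notMem (Finset.notMem_empty e), hf₀, insert_empty_eq]; grind)
      (by rw [fixCoord_of_notMem (Finset.notMem_empty e), hg₀, insert_empty_eq]; grind)
      fun I hI => by
        have hpI := hp I (hI.trans (Finset.subset_insert e s))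
        have hpeI := hp (insert e I) (Finset.insert_subset_insert e hI)
        have haI := ha I hI
        rw [Finset.sum_insert (notMem hI)] at hpeI haI
        rw [fixCoord_of_notMem (notMem hI), fixCoord_of_notMem (notMem hI)]
        grind
    refine ⟨Function.update q e a, fun I hI => ?_⟩
    have hqI := hq (I.erase e) (Finset.subset_insert_iff.1 hI)
    have hupdate : ∑ i ∈ I.erase e, Function.update q e a i = ∑ i ∈ I.erase e, q i :=
      Finset.sum_congr rfl fun i hi => Function.update_of_ne (Finset.ne_of_mem_erase hi) _ _
    simp only [Finset.sum_sub_distrib, fixCoord_of_notMem (Finset.notMem_erase e I)] at hqI ⊢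
    by_cases heI : e ∈ I
    · rw [Finset.insert_erase heI] at hqI
      rw [← Finset.add_sum_erase I _ heI, ← Finset.add_sum_erase I p heI, hupdate,
        Function.update_self]
      grind
    · rw [Finset.erase_eq_of_notMem heI] at hqI hupdate
      grind

end Submodular

section BasePolytope

variable {α R : Type*} [Fintype α]

/-- The base polytope of a set function `f` with values in an ordered group: over `ℝ` the polytope
itself, over `ℤ` its set of lattice points. -/
def basePolytope [AddCommMonoid R] [LE R] (f : Finset α → R) : Set (α → R) :=
  {t | (∀ I, ∑ i ∈ I, t i ≤ f I) ∧ ∑ i, t i = f Finset.univ}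

theorem basePolytope_zero [AddCommMonoid R] [PartialOrder R] [IsOrderedAddMonoid R] :
    basePolytope (0 : Finset α → R) = 0 := by
  ext t
  refine ⟨fun ht => ?_, ?_⟩
  · have hle i : t i ≤ 0 := by simpa using ht.1 {i}
    exact funext fun i =>
      (Finset.sum_eq_zero_iff_of_nonpos fun i _ => hle i).1 ht.2 i (Finset.mem_univ i)
  · rintro rfl
    simp [basePolytope]

theorem add_mem_basePolytope [AddCommMonoid R] [PartialOrder R] [IsOrderedAddMonoid R]
    {f g : Finset α → R} {t u : α → R} (ht : t ∈ basePolytope f) (hu : u ∈ basePolytope g) :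
    t + u ∈ basePolytope (f + g) := by
  simp only [basePolytope, Set.mem_ofPred_eq, Pi.add_apply, Finset.sum_add_distrib]
  exact ⟨fun I => add_le_add (ht.1 I) (hu.1 I), by rw [ht.2, hu.2]⟩

theorem intCast_mem_basePolytope [Ring R] [PartialOrder R] [IsStrictOrderedRing R]
    {f : Finset α → ℤ} {p : α → ℤ} :
    (fun i => (p i : R)) ∈ basePolytope (fun I => (f I : R)) ↔ p ∈ basePolytope f := by
  simp only [basePolytope, Set.mem_ofPred_eq, ← Int.cast_sum, Int.cast_le, Int.cast_inj]

variable [DecidableEq α] [AddCommGroup R] [LinearOrder R] [IsOrderedAddMonoid R]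

theorem basePolytope_add {f g : Finset α → R} (hf : IsSubmodular f) (hg : IsSubmodular g)
    (hf₀ : f ∅ = 0) (hg₀ : g ∅ = 0) :
    basePolytope (f + g) = basePolytope f + basePolytope g := by
  apply Set.Subset.antisymm
  · rintro p ⟨hp, hp'⟩
    obtain ⟨q, hq⟩ := hf.exists_sum_le_and_sum_sub_le hg hf₀ hg₀ Finset.univ fun I _ => hp I
    have huniv := hq Finset.univ subset_rfl
    rw [Pi.add_apply] at hp'
    rw [Finset.sum_sub_distrib] at huniv
    refine ⟨q, ⟨fun I => (hq I (Finset.subset_univ I)).1, by grind⟩, p - q,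
      ⟨fun I => (hq I (Finset.subset_univ I)).2, ?_⟩, add_sub_cancel q p⟩
    simp only [Pi.sub_apply, Finset.sum_sub_distrib]
    grind
  · rintro _ ⟨t, ht, u, hu, rfl⟩
    exact add_mem_basePolytope ht hu

theorem basePolytope_sum {ι : Type*} {s : Finset ι} {f : ι → Finset α → R}
    (hf : ∀ j ∈ s, IsSubmodular (f j)) (hf₀ : ∀ j ∈ s, f j ∅ = 0) :
    basePolytope (∑ j ∈ s, f j) = ∑ j ∈ s, basePolytope (f j) := by
  classical
  induction s using Finset.induction_on with
  | empty => simp only [Finset.sum_empty, basePolytope_zero]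
  | insert j s hj ih =>
    simp only [Finset.forall_mem_insert] at hf hf₀
    rw [Finset.sum_insert hj, Finset.sum_insert hj,
      basePolytope_add hf.1 (isSubmodular_sum hf.2) hf₀.1 ?_, ih hf.2 hf₀.2]
    rw [Finset.sum_apply, Finset.sum_eq_zero hf₀.2]

end BasePolytope

section GreedyVertex

variable {α β R : Type*}

/-- The elements of `α` that `π` puts strictly above `k`. -/
def above [Fintype α] [LT β] [DecidableLT β] (π : α → β) (k : β) : Finset α :=
  {i | k < π i}

theorem mem_above [Fintype α] [LT β] [DecidableLT β] {π : α → β} {k : β} {i : α} :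
    i ∈ above π k ↔ k < π i := by
  rw [above, Finset.mem_filter_univ]

/-- A finite set is closed upwards for the order that `π` induces on `α`. -/
def IsUpperClosed [LE β] (π : α → β) (I : Finset α) : Prop :=
  ∀ i ∈ I, ∀ j, π i ≤ π j → j ∈ I

theorem isUpperClosed_univ [Fintype α] [LE β] (π : α → β) : IsUpperClosed π Finset.univ :=
  fun _ _ j _ => Finset.mem_univ j

/-- The vertex of the base polytope of `f` that the greedy algorithm reaches by taking the
elements in decreasing order of `π`: the marginal value of each element over those above it. -/
def greedyVertex [Fintype α] [DecidableEq α] [LT β] [DecidableLT β] [Sub R]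
    (f : Finset α → R) (π : α → β) : α → R :=
  fun i => f (insert i (above π (π i))) - f (above π (π i))

variable [LinearOrder β] {π : α → β}

theorem IsUpperClosed.of_insert [DecidableEq α] (hπ : π.Injective) {a : α} {s : Finset α}
    (ha : a ∉ s) (hmin : ∀ i ∈ s, π a ≤ π i) (hI : IsUpperClosed π (insert a s)) :
    IsUpperClosed π s := by
  intro i hi j hij
  refine Finset.mem_of_mem_insert_of_ne (hI i (Finset.mem_insert_of_mem hi) j hij) ?_
  rintro rfl
  exact ha (hπ (hij.antisymm (hmin i hi)) ▸ hi)

-- Abel summation: remove the elements of `I` one at a time, in increasing order of `π`.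
theorem IsUpperClosed.mul_sum_le_sum_mul [CommRing R] [PartialOrder R] [IsOrderedRing R]
    (hπ : π.Injective) {c d : α → R} (hc : ∀ i j, π i ≤ π j → c i ≤ c j)
    (hd : ∀ I, IsUpperClosed π I → 0 ≤ ∑ i ∈ I, d i) {I : Finset α} (hI : IsUpperClosed π I)
    {b : R} (hb : ∀ i ∈ I, b ≤ c i) : b * ∑ i ∈ I, d i ≤ ∑ i ∈ I, c i * d i := by
  classical
  induction I using Finset.induction_on_min_value π generalizing b with
  | empty => simp only [Finset.sum_empty, mul_zero, le_refl]
  | insert a s ha hmin ih =>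
    calc b * ∑ i ∈ insert a s, d i
        ≤ c a * ∑ i ∈ insert a s, d i :=
          mul_le_mul_of_nonneg_right (hb a (Finset.mem_insert_self a s)) (hd _ hI)
      _ = c a * d a + c a * ∑ i ∈ s, d i := by rw [Finset.sum_insert ha, mul_add]
      _ ≤ c a * d a + ∑ i ∈ s, c i * d i := by
          gcongr
          exact ih (hI.of_insert hπ ha hmin) fun i hi => hc a i (hmin i hi)
      _ = ∑ i ∈ insert a s, c i * d i := (Finset.sum_insert (f := fun i => c i * d i) ha).symm

variable [Fintype α] [DecidableEq α]

theorem greedyVertex_intCast {R : Type*} [AddGroupWithOne R] (f : Finset α → ℤ) (π : α → β) :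
    greedyVertex (fun I => (f I : R)) π = fun i => ((greedyVertex f π i : ℤ) : R) := by
  ext i
  simp only [greedyVertex, Int.cast_sub]

theorem sum_greedyVertex_le [AddCommGroup R] [PartialOrder R] [IsOrderedAddMonoid R]
    {f : Finset α → R} (hf : IsSubmodular f) (hf₀ : f ∅ = 0) (hπ : π.Injective)
    (I : Finset α) : ∑ i ∈ I, greedyVertex f π i ≤ f I := by
  induction I using Finset.induction_on_min_value π with
  | empty => simp only [Finset.sum_empty, hf₀, le_refl]
  | insert a s ha hmin ih =>
    have habove : s ⊆ above π (π a) := fun i hi =>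
      mem_above.2 ((hmin i hi).lt_of_ne fun h => ha (hπ h ▸ hi))
    have hsub := hf (above π (π a)) (insert a s)
    rw [Finset.union_insert, Finset.union_eq_left.2 habove,
      Finset.inter_insert_of_notMem (fun h => (mem_above.1 h).false),
      Finset.inter_eq_right.2 habove] at hsub
    calc ∑ i ∈ insert a s, greedyVertex f π i
        ≤ f (insert a (above π (π a))) - f (above π (π a)) + f s := by
          rw [Finset.sum_insert ha, greedyVertex]
          gcongr
      _ = f (insert a (above π (π a))) + f s - f (above π (π a)) := sub_add_eq_add_sub _ _ _
      _ ≤ f (insert a s) := sub_le_iff_le_add'.2 hsub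

theorem sum_greedyVertex_of_isUpperClosed [AddCommGroup R] {f : Finset α → R} (hf₀ : f ∅ = 0)
    (hπ : π.Injective) {I : Finset α} (hI : IsUpperClosed π I) :
    ∑ i ∈ I, greedyVertex f π i = f I := by
  induction I using Finset.induction_on_min_value π with
  | empty => simp only [Finset.sum_empty, hf₀]
  | insert a s ha hmin ih =>
    have habove : above π (π a) = s := by
      ext j
      refine ⟨fun hj => ?_, fun hj => ?_⟩ <;> rw [mem_above] at *
      · exact Finset.mem_of_mem_insert_of_ne (hI a (Finset.mem_insert_self a s) j hj.le)
          fun h => hj.ne (h ▸ rfl)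
      · exact (hmin j hj).lt_of_ne fun h => ha (hπ h ▸ hj)
    rw [Finset.sum_insert ha, greedyVertex, habove, ih (hI.of_insert hπ ha hmin), sub_add_cancel]

theorem greedyVertex_mem_basePolytope [AddCommGroup R] [PartialOrder R] [IsOrderedAddMonoid R]
    {f : Finset α → R} (hf : IsSubmodular f) (hf₀ : f ∅ = 0) (hπ : π.Injective) :
    greedyVertex f π ∈ basePolytope f :=
  ⟨sum_greedyVertex_le hf hf₀ hπ, sum_greedyVertex_of_isUpperClosed hf₀ hπ (isUpperClosed_univ π)⟩

theorem sum_mul_le_sum_mul_greedyVertex [CommRing R] [LinearOrder R] [IsStrictOrderedRing R]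
    {f : Finset α → R} (hf₀ : f ∅ = 0) (hπ : π.Injective) {c t : α → R}
    (hc : ∀ i j, π i ≤ π j → c i ≤ c j) (ht : t ∈ basePolytope f) :
    ∑ i, c i * t i ≤ ∑ i, c i * greedyVertex f π i := by
  have hsum {I : Finset α} (hI : IsUpperClosed π I) :
      ∑ i ∈ I, (greedyVertex f π i - t i) = f I - ∑ i ∈ I, t i := by
    rw [Finset.sum_sub_distrib, sum_greedyVertex_of_isUpperClosed hf₀ hπ hI]
  obtain ⟨b, hb⟩ := (Set.finite_range c).bddBelow
  have habel := (isUpperClosed_univ π).mul_sum_le_sum_mul hπ hc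
    (fun I hI => (hsum hI).symm ▸ sub_nonneg.2 (ht.1 I)) (fun i _ => hb ⟨i, rfl⟩)
  rw [hsum (isUpperClosed_univ π), ht.2, sub_self, mul_zero] at habel
  simpa only [mul_sub, Finset.sum_sub_distrib, sub_nonneg] using habel

end GreedyVertex

section ConvexHull

theorem exists_equiv_fin_monotone {α R : Type*} [LinearOrder R] {m : ℕ} (e : α ≃ Fin m)
    (c : α → R) : ∃ π : α ≃ Fin m, ∀ i j, π i ≤ π j → c i ≤ c j := by
  refine ⟨e.trans (Tuple.sort (c ∘ e.symm)).symm, fun i j hij => ?_⟩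
  simpa using Tuple.monotone_sort (c ∘ e.symm) hij

variable {α : Type*} [Fintype α]

theorem convex_basePolytope {R : Type*} [CommRing R] [PartialOrder R] [IsOrderedRing R]
    (f : Finset α → R) : Convex R (basePolytope f) := by
  have hlin (I : Finset α) : IsLinearMap R fun t : α → R => ∑ i ∈ I, t i :=
    ⟨fun t u => by simp only [Pi.add_apply, Finset.sum_add_distrib],
      fun a t => by simp only [Pi.smul_apply, Finset.smul_sum]⟩
  rw [basePolytope, Set.ofPred_and, Set.ofPred_forall]
  exact (convex_iInter fun I => convex_halfSpace_le (hlin I) _).inter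
    (convex_hyperplane (hlin Finset.univ) _)

variable [DecidableEq α]

theorem basePolytope_eq_convexHull_greedyVertex {f : Finset α → ℝ} (hf : IsSubmodular f)
    (hf₀ : f ∅ = 0) {m : ℕ} (e : α ≃ Fin m) :
    basePolytope f = convexHull ℝ (Set.range fun π : α ≃ Fin m => greedyVertex f π) := by
  apply Set.Subset.antisymm
  · intro t ht
    by_contra hnot
    obtain ⟨l, u, hl, hu⟩ := geometric_hahn_banach_closed_point (convex_convexHull ℝ _)
      ((Set.finite_range fun π : α ≃ Fin m => greedyVertex f π).isClosed_convexHull ℝ) hnot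
    have hl_apply (v : α → ℝ) : l v = ∑ i, l (Pi.single i 1) * v i := by
      conv_lhs => rw [pi_eq_sum_univ' v, map_sum]
      simp only [map_smul, smul_eq_mul, mul_comm]
    obtain ⟨π, hπ⟩ := exists_equiv_fin_monotone e fun i => l (Pi.single i 1)
    have hle : l t ≤ l (greedyVertex f π) := by
      rw [hl_apply, hl_apply]
      exact sum_mul_le_sum_mul_greedyVertex hf₀ π.injective hπ ht
    exact (hle.trans_lt (hl _ (subset_convexHull ℝ _ ⟨π, rfl⟩))).not_gt hu
  · refine convexHull_min ?_ (convex_basePolytope f)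
    rintro _ ⟨π, rfl⟩
    exact greedyVertex_mem_basePolytope hf hf₀ π.injective

theorem basePolytope_intCast_eq_convexHull {f : Finset α → ℤ} (hf : IsSubmodular f)
    (hf₀ : f ∅ = 0) :
    basePolytope (fun I => (f I : ℝ)) =
      convexHull ℝ ((fun (p : α → ℤ) i => (p i : ℝ)) '' basePolytope f) := by
  apply Set.Subset.antisymm
  · rw [basePolytope_eq_convexHull_greedyVertex hf.intCast (by rw [hf₀, Int.cast_zero])
      (Fintype.equivFin α)]
    refine convexHull_mono ?_
    rintro _ ⟨π, rfl⟩
    exact ⟨greedyVertex f π, greedyVertex_mem_basePolytope hf hf₀ π.injective,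
      (greedyVertex_intCast f π).symm⟩
  · refine convexHull_min ?_ (convex_basePolytope _)
    rintro _ ⟨p, hp, rfl⟩
    exact intCast_mem_basePolytope.2 hp

end ConvexHull

section Edges

variable {α β R : Type*} [LinearOrder β] {k l : β}

theorem lt_swap_apply_iff (hkl : k ⋖ l) {a b : β} (ha : a ≠ k) :
    a < Equiv.swap k l b ↔ a < b := by
  have hlt := hkl.lt
  have hbetween := @hkl.2 a
  rw [Equiv.swap_apply_def]
  grind

variable [Fintype α]

theorem above_swap (hkl : k ⋖ l) (π : α → β) {a : β} (ha : a ≠ k) :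
    above (Equiv.swap k l ∘ π) a = above π a := by
  ext j
  rw [mem_above, mem_above, Function.comp_apply, lt_swap_apply_iff hkl ha]

variable [DecidableEq α]

theorem above_eq_insert_above (hkl : k ⋖ l) (π : α ≃ β) :
    above π k = insert (π.symm l) (above π l) := by
  ext j
  rw [mem_above, hkl.lt_iff_le_right, Finset.mem_insert, mem_above, Equiv.eq_symm_apply,
    le_iff_eq_or_lt, eq_comm]

theorem above_swap_left (hkl : k ⋖ l) (π : α ≃ β) :
    above (Equiv.swap k l ∘ π) k = insert (π.symm k) (above π l) := by
  rw [← above_swap hkl π hkl.ne', ← Equiv.coe_trans, above_eq_insert_above hkl]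
  simp

theorem IsSubmodular.exists_greedyVertex_swap_sub_eq [AddCommGroup R] [PartialOrder R]
    [IsOrderedAddMonoid R] {f : Finset α → R} (hf : IsSubmodular f) (π : α ≃ β) (hkl : k ⋖ l) :
    ∃ c, 0 ≤ c ∧ greedyVertex f (Equiv.swap k l ∘ π) - greedyVertex f π =
      Pi.single (π.symm k) c - Pi.single (π.symm l) c := by
  have hne : π.symm k ≠ π.symm l := π.symm.injective.ne hkl.ne
  have habove_k := above_eq_insert_above hkl π
  have hswap_k := above_swap_left hkl π
  have hswap_l := above_swap hkl π hkl.ne'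
  have hk : π.symm k ∉ above π l := fun h => by simpa [hkl.lt.not_gt] using mem_above.1 h
  have hl : π.symm l ∉ above π l := fun h => by simpa using mem_above.1 h
  set U := above π l
  refine ⟨f (insert (π.symm k) U) + f (insert (π.symm l) U) -
    (f (insert (π.symm k) (insert (π.symm l) U)) + f U), ?_, ?_⟩
  · have hsub := hf (insert (π.symm k) U) (insert (π.symm l) U)
    rw [Finset.insert_union, Finset.union_insert, Finset.union_self,
      Finset.insert_inter_of_notMem (by grind), Finset.inter_insert_of_notMem hl,
      Finset.inter_self] at hsub
    exact sub_nonneg.2 hsub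
  · ext i
    simp only [Pi.sub_apply, greedyVertex, Function.comp_apply]
    obtain rfl | hik := eq_or_ne i (π.symm k)
    · rw [Equiv.apply_symm_apply, Equiv.swap_apply_left, hswap_l, habove_k, Pi.single_eq_same,
        Pi.single_eq_of_ne hne]
      abel
    obtain rfl | hil := eq_or_ne i (π.symm l)
    · rw [Equiv.apply_symm_apply, Equiv.swap_apply_right, hswap_k, Pi.single_eq_same,
        Pi.single_eq_of_ne hne.symm, Finset.insert_comm]
      abel
    · have hπk := mt (Equiv.eq_symm_apply π).2 hik
      rw [Equiv.swap_apply_of_ne_of_ne hπk (mt (Equiv.eq_symm_apply π).2 hil),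
        above_swap hkl π hπk, sub_self, Pi.single_eq_of_ne hik, Pi.single_eq_of_ne hil, sub_self]

theorem permVertex_swap_sub_permVertex {n : ℕ} {k l : Fin n} (hkl : (l : ℕ) = k + 1)
    (π : Equiv.Perm (Fin n)) :
    permVertex (Equiv.swap k l * π) - permVertex π =
      Pi.single (π.symm k) 1 - Pi.single (π.symm l) 1 := by
  have hkl' : ((l : ℕ) : ℝ) = (k : ℕ) + 1 := by rw [hkl, Nat.cast_succ]
  ext i
  simp only [Pi.sub_apply, permVertex, Equiv.Perm.mul_apply, Pi.single_apply, Equiv.eq_symm_apply]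
  rw [Equiv.swap_apply_def]
  split_ifs with hk hl hl <;> grind

theorem isGeneralizedPermutahedron_basePolytope {n : ℕ} {f : Finset (Fin n) → ℝ}
    (hf : IsSubmodular f) (hf₀ : f ∅ = 0) : IsGeneralizedPermutahedron (basePolytope f) := by
  refine ⟨fun π => greedyVertex f π,
    basePolytope_eq_convexHull_greedyVertex hf hf₀ (Equiv.refl _), fun π k l hkl => ?_⟩
  have hcov : k ⋖ l := ⟨by grind, fun a hka hal => by grind⟩
  obtain ⟨c, hc, heq⟩ := hf.exists_greedyVertex_swap_sub_eq π hcov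
  refine ⟨c, hc, ?_⟩
  rw [permVertex_swap_sub_permVertex hkl, smul_sub, ← Pi.single_smul, ← Pi.single_smul,
    smul_eq_mul, mul_one]
  exact heq

end Edges

section Matroid

variable {α : Type*} {M : Matroid α}

/-- The rank function of a matroid on finite sets, with values in `ℤ`, where it can serve as a
submodular function in `IsSubmodular` and `basePolytope`. -/
def intRank (M : Matroid α) (I : Finset α) : ℤ :=
  (M.eRk I).toNat

theorem natCast_toNat_eRk (M : Matroid α) (I : Finset α) : ((M.eRk I).toNat : ℕ∞) = M.eRk I :=
  ENat.natCast_toNat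
    (ne_top_of_le_ne_top (Set.encard_ne_top_iff.2 I.finite_toSet) (M.eRk_le_encard I))

theorem eRk_eq_natCast_iff {I : Finset α} {r : ℕ} : M.eRk I = r ↔ intRank M I = r := by
  rw [← natCast_toNat_eRk, intRank, Nat.cast_inj, Nat.cast_inj]

theorem intRank_empty (M : Matroid α) : intRank M ∅ = 0 := by
  rw [intRank, Finset.coe_empty, Matroid.eRk_empty, ENat.toNat_zero, Nat.cast_zero]

theorem intRank_mono (M : Matroid α) : Monotone (intRank M) := fun I J hIJ => by
  have h := M.eRk_mono (Finset.coe_subset.2 hIJ)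
  rw [← natCast_toNat_eRk, ← natCast_toNat_eRk M J, Nat.cast_le] at h
  exact Int.ofNat_le.2 h

theorem intRank_le_card (M : Matroid α) (I : Finset α) : intRank M I ≤ I.card := by
  have h := M.eRk_le_encard I
  rw [← natCast_toNat_eRk, Set.encard_coe_eq_coe_finsetCard, Nat.cast_le] at h
  exact Int.ofNat_le.2 h

theorem indep_iff_intRank_eq_card {I : Finset α} : M.Indep I ↔ intRank M I = I.card := by
  rw [Matroid.indep_iff_eRk_eq_encard_of_finite I.finite_toSet, Set.encard_coe_eq_coe_finsetCard,
    eRk_eq_natCast_iff]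

theorem isBase_iff_intRank_eq_card [Fintype α] {B : Finset α} :
    M.IsBase B ↔ intRank M B = B.card ∧ intRank M Finset.univ = B.card := by
  rw [← indep_iff_intRank_eq_card, ← eRk_eq_natCast_iff, Finset.coe_univ, Matroid.eRk_univ_eq,
    ← Set.encard_coe_eq_coe_finsetCard]
  exact ⟨fun hB => ⟨hB.indep, hB.encard_eq_eRank.symm⟩, fun ⟨hB, hrank⟩ =>
    hB.isBase_of_eRk_ge B.finite_toSet (by rw [hB.eRk_eq_encard, hrank])⟩

variable [DecidableEq α]

theorem isSubmodular_intRank (M : Matroid α) : IsSubmodular (intRank M) := fun I J => by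
  have h := M.eRk_inter_add_eRk_union_le (I : Set α) J
  rw [← Finset.coe_inter, ← Finset.coe_union] at h
  rw [← natCast_toNat_eRk, ← natCast_toNat_eRk M (I ∪ J), ← natCast_toNat_eRk M I,
    ← natCast_toNat_eRk M J, ← Nat.cast_add, ← Nat.cast_add, Nat.cast_le] at h
  simp only [intRank]
  omega

theorem mem_basePolytope_intRank_iff [Fintype α] {p : α → ℤ} :
    p ∈ basePolytope (intRank M) ↔
      ∃ B : Finset α, M.IsBase B ∧ (fun i => if i ∈ B then 1 else 0) = p := by
  have sum_indicator (B I : Finset α) : ∑ i ∈ I, (if i ∈ B then 1 else 0) = ((I ∩ B).card : ℤ) := by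
    rw [Finset.sum_boole, Finset.filter_mem_eq_inter]
  constructor
  · rintro ⟨hle, huniv⟩
    have le_one i : p i ≤ 1 := by simpa using (hle {i}).trans (intRank_le_card M {i})
    have nonneg i : 0 ≤ p i := by
      have := (hle (Finset.univ.erase i)).trans (intRank_mono M (Finset.subset_univ _))
      have := Finset.add_sum_erase Finset.univ p (Finset.mem_univ i)
      lia
    obtain ⟨B, rfl⟩ : ∃ B : Finset α, (fun i => if i ∈ B then 1 else 0) = p := by
      refine ⟨({i | p i = 1} : Finset α), funext fun i => ?_⟩
      have := le_one i
      have := nonneg i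
      simp only [Finset.mem_filter_univ]
      split_ifs <;> lia
    have hB := hle B
    rw [sum_indicator, Finset.inter_self] at hB
    rw [sum_indicator, Finset.univ_inter] at huniv
    exact ⟨B, isBase_iff_intRank_eq_card.2 ⟨(intRank_le_card M B).antisymm hB, huniv.symm⟩, rfl⟩
  · rintro ⟨B, hB, rfl⟩
    refine ⟨fun I => ?_, ?_⟩
    · have hindep := hB.indep.subset (Finset.coe_subset.2 (I.inter_subset_right (s₂ := B)))
      rw [sum_indicator, ← indep_iff_intRank_eq_card.1 hindep]
      exact intRank_mono M Finset.inter_subset_left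
    · rw [sum_indicator, Finset.univ_inter, (isBase_iff_intRank_eq_card.1 hB).2]

theorem matroidPolytope_eq_basePolytope {n : ℕ} (M : Matroid (Fin n)) :
    matroidPolytope M = basePolytope fun I => (intRank M I : ℝ) := by
  ext t
  simp only [matroidPolytope, basePolytope, intRank, Set.mem_ofPred_eq, Finset.coe_univ,
    Int.cast_natCast]
  refine and_congr_left fun huniv => forall_congr' fun I => ⟨fun hI => ?_, fun hI _ => hI⟩
  obtain rfl | hne := eq_or_ne I Finset.univ
  · rw [huniv, Finset.coe_univ]
  · exact hI hne

theorem schubertMatroid_isBase_iff {n : ℕ} {S R : Finset (Fin n)} :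
    (schubertMatroid S).IsBase R ↔ GaleLE R S :=
  ⟨fun ⟨_, hR, hle⟩ => Finset.coe_injective hR ▸ hle, fun hle => ⟨R, rfl, hle⟩⟩

end Matroid

section Eigenbasis

theorem coord_comp_eq_smul_coord {R V κ : Type*} [CommSemiring R] [AddCommMonoid V] [Module R V]
    (b : Module.Basis κ R V) {T : Module.End R V} {c : κ → R} (hT : ∀ k, T (b k) = c k • b k)
    (k : κ) : b.coord k ∘ₗ T = c k • b.coord k :=
  b.ext fun l => by
    obtain rfl | hkl := eq_or_ne l k
    · simp [hT]
    · simp [hT, Finsupp.single_eq_of_ne' hkl]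

theorem trace_eq_sum_of_apply_basis {R V κ : Type*} [CommRing R] [AddCommGroup V] [Module R V]
    [Fintype κ] (b : Module.Basis κ R V) {T : Module.End R V} {c : κ → R}
    (hT : ∀ k, T (b k) = c k • b k) : LinearMap.trace R V T = ∑ k, c k := by
  classical
  rw [LinearMap.trace_eq_matrix_trace R b, Matrix.trace]
  refine Finset.sum_congr rfl fun k _ => ?_
  simp [LinearMap.toMatrix_apply, hT]

theorem exists_finset_trace_eq_sum {K V ι X : Type*} [Field K] [AddCommGroup V] [Module K V]
    [Finite ι] {T : X → Module.End K V} {v : ι → V} {c : ι → X → K}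
    (hT : ∀ x i, T x (v i) = c i x • v i) (hv : ∀ i, v i ≠ 0)
    (hspan : Submodule.span K (Set.range v) = ⊤) :
    ∃ s : Finset ι, (∀ x, LinearMap.trace K V (T x) = ∑ i ∈ s, c i x) ∧
      ∀ i, ∃ j ∈ s, c j = c i := by
  obtain ⟨κ, a, ha, hspan_a, hli⟩ := exists_linearIndependent' K v
  have := Finite.of_injective a ha
  have := Fintype.ofFinite κ
  let b := Module.Basis.mk hli (hspan_a.trans hspan).ge
  have hTb x k : T x (b k) = c (a k) x • b k := by
    simp only [b, Module.Basis.mk_apply, Function.comp_apply, hT]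
  refine ⟨Finset.univ.map ⟨a, ha⟩, fun x => ?_, fun i => ?_⟩
  · rw [trace_eq_sum_of_apply_basis b (hTb x), Finset.sum_map, Function.Embedding.coeFn_mk]
  · obtain ⟨k, hk⟩ : ∃ k, b.coord k (v i) ≠ 0 := by
      by_contra! h
      exact hv i (b.forall_coord_eq_zero_iff.1 h)
    refine ⟨a k, Finset.mem_map_of_mem _ (Finset.mem_univ k), funext fun x => ?_⟩
    have heigen := LinearMap.congr_fun (coord_comp_eq_smul_coord b (hTb x) k) (v i)
    rw [LinearMap.comp_apply, hT, map_smul, LinearMap.smul_apply, smul_eq_mul,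
      smul_eq_mul] at heigen
    exact (mul_right_cancel₀ hk heigen).symm

end Eigenbasis

section Polynomials

theorem eq_of_forall_eval_units {σ K : Type*} [Field K] [Infinite K] {p q : MvPolynomial σ K}
    (h : ∀ x : σ → Kˣ, MvPolynomial.eval (fun i => (x i : K)) p =
      MvPolynomial.eval (fun i => (x i : K)) q) : p = q :=
  MvPolynomial.funext_set (fun _ => {0}ᶜ) (fun _ => (Set.finite_singleton 0).infinite_compl)
    fun x hx => h fun i => Units.mk0 (x i) (hx i (Set.mem_univ i))

theorem coeff_sum_monomial_one {σ ι R : Type*} [DecidableEq σ] [CommSemiring R] (s : Finset ι)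
    (w : ι → σ →₀ ℕ) (m : σ →₀ ℕ) :
    (∑ i ∈ s, MvPolynomial.monomial (w i) (1 : R)).coeff m = ((s.filter (w · = m)).card : R) := by
  simp only [MvPolynomial.coeff_sum, MvPolynomial.coeff_monomial, Finset.sum_boole]

theorem mem_support_sum_monomial_one_iff {σ ι R : Type*} [CommSemiring R] [CharZero R]
    {s : Finset ι} {w : ι → σ →₀ ℕ} {m : σ →₀ ℕ} :
    m ∈ (∑ i ∈ s, MvPolynomial.monomial (w i) (1 : R)).support ↔ ∃ i ∈ s, w i = m := by
  classical
  rw [MvPolynomial.mem_support_iff, coeff_sum_monomial_one, Nat.cast_ne_zero,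
    Finset.card_ne_zero, Finset.filter_nonempty_iff]

end Polynomials

section WeylModule

variable {n : ℕ} {D : Fin n → Finset (Fin n)}

theorem dualCharacter_eq_trace_inv {N : Type*} [AddCommGroup N] [Module ℂ N] [Module.Finite ℂ N]
    (ρ : Representation ℂ (borel n) N) (x : Fin n → ℂˣ) :
    dualCharacter ρ x = LinearMap.trace ℂ N (ρ (torus x)⁻¹) := by
  rw [dualCharacter, character, Representation.dual_apply, LinearMap.trace_transpose']

theorem translate_torus_inv_genericUpper (x : Fin n → ℂˣ) (i j : Fin n) :
    translate (torus x)⁻¹ (genericUpper n i j) =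
      MvPolynomial.C (x i : ℂ) * genericUpper n i j := by
  have torus_map : ((torus x : borel n) : GL (Fin n) ℂ).val.map
      (MvPolynomial.C : ℂ →+* CoordRing n) =
      Matrix.diagonal fun i => MvPolynomial.C (x i : ℂ) :=
    Matrix.diagonal_map (map_zero _)
  rw [translate_genericUpper, invMulGeneric, inv_inv, torus_map, Matrix.diagonal_mul]

theorem translate_torus_inv_minor (x : Fin n → ℂˣ) (R S : Finset (Fin n))
    (h : S.card = R.card) :
    translate (torus x)⁻¹ (minor R S h) = (∏ i ∈ S, (x i : ℂ)) • minor R S h := by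
  have prod_rows : ∏ i ∈ S, (MvPolynomial.C (x i : ℂ) : CoordRing n) =
      ∏ k : Fin R.card, MvPolynomial.C (x (S.orderEmbOfFin h k) : ℂ) := by
    conv_lhs => rw [← Finset.map_orderEmbOfFin_univ S h, Finset.prod_map]
    rfl
  rw [MvPolynomial.smul_eq_C_mul, map_prod, prod_rows, minor, ← Matrix.det_mul_column,
    AlgHom.map_det]
  congr 1
  ext1 k l
  exact translate_torus_inv_genericUpper x _ _

theorem aeval_minor {A : Type*} [CommRing A] [Algebra ℂ A] {U : Matrix (Fin n) (Fin n) A}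
    (hU : U.BlockTriangular id) (R S : Finset (Fin n)) (h : S.card = R.card) :
    MvPolynomial.aeval (fun p => U p.1.1 p.1.2) (minor R S h) =
      (U.submatrix (S.orderEmbOfFin h) (R.orderEmbOfFin rfl)).det := by
  rw [minor, AlgHom.map_det]
  congr 1
  ext k l
  rw [AlgHom.mapMatrix_apply, Matrix.map_apply, Matrix.submatrix_apply, Matrix.submatrix_apply,
    genericUpper, Matrix.of_apply]
  split_ifs with hkl
  · rw [MvPolynomial.aeval_X]
  · rw [map_zero, hU (not_le.1 hkl)]

theorem minor_ne_zero {R S : Finset (Fin n)} (h : GaleLE S R) : minor R S h.fst ≠ 0 := by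
  classical
  obtain ⟨hcard, hle⟩ := h
  let U : Matrix (Fin n) (Fin n) ℂ := Matrix.of fun i j =>
    if ∃ k, S.orderEmbOfFin hcard k = i ∧ R.orderEmbOfFin rfl k = j then 1 else 0
  have hU : U.BlockTriangular id := fun i j hji => by
    refine if_neg ?_
    rintro ⟨k, rfl, rfl⟩
    exact (hle k).not_gt hji
  have submatrix_eq_one : U.submatrix (S.orderEmbOfFin hcard) (R.orderEmbOfFin rfl) = 1 := by
    ext k l
    simp [U, Matrix.one_apply]
  intro hzero
  have haeval := aeval_minor hU R S hcard
  rw [hzero, map_zero, submatrix_eq_one, Matrix.det_one] at haeval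
  exact zero_ne_one haeval

/-- The tuples `C ≤ D`, which index the products of minors spanning the flagged Weyl module. -/
abbrev TuplesBelow (D : Fin n → Finset (Fin n)) : Type :=
  {C : Fin n → Finset (Fin n) // ∀ j, GaleLE (C j) (D j)}

/-- The product of minors `∏_j det(Y_{D_j}^{C_j})` as an element of the flagged Weyl module. -/
def minorProd (C : TuplesBelow D) : (weylSubrep D).toSubmodule :=
  ⟨∏ j, minor (D j) (C.1 j) (C.2 j).fst, Submodule.subset_span ⟨C.1, C.2, rfl⟩⟩

theorem span_range_minorProd :
    Submodule.span ℂ (Set.range (minorProd (D := D))) = ⊤ := by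
  apply Submodule.map_injective_of_injective (weylSubrep D).toSubmodule.injective_subtype
  rw [Submodule.map_span, Submodule.map_top, Submodule.range_subtype, ← Set.range_comp]
  refine congrArg (Submodule.span ℂ) (Set.ext fun f => ⟨?_, ?_⟩)
  · rintro ⟨C, rfl⟩
    exact ⟨C.1, C.2, rfl⟩
  · rintro ⟨C, h, rfl⟩
    exact ⟨⟨C, h⟩, rfl⟩

theorem minorProd_ne_zero (C : TuplesBelow D) : minorProd C ≠ 0 := fun hzero => by
  have hprod : ∏ j, minor (D j) (C.1 j) (C.2 j).fst ≠ 0 :=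
    Finset.prod_ne_zero_iff.2 fun j _ => minor_ne_zero (C.2 j)
  exact hprod (congrArg Subtype.val hzero)

/-- The exponent vector `∑_j 1_{C_j}`, which is the torus weight of the product of minors indexed
by `C`. -/
def weight (C : Fin n → Finset (Fin n)) : Fin n →₀ ℕ :=
  ∑ j, ∑ i ∈ C j, Finsupp.single i 1

theorem weight_apply (C : Fin n → Finset (Fin n)) (i : Fin n) :
    weight C i = ∑ j, if i ∈ C j then 1 else 0 := by
  simp [weight, Finsupp.finsetSum_apply, Finsupp.single_apply]

theorem eval_monomial_weight {R : Type*} [CommSemiring R] (x : Fin n → R)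
    (C : Fin n → Finset (Fin n)) :
    MvPolynomial.eval x (MvPolynomial.monomial (weight C) 1) = ∏ j, ∏ i ∈ C j, x i := by
  simp only [weight, MvPolynomial.monomial_sum_one, map_prod, ← MvPolynomial.X.eq_1,
    MvPolynomial.eval_X]

theorem weylModule_torus_inv_minorProd (x : Fin n → ℂˣ) (C : TuplesBelow D) :
    weylModule D (torus x)⁻¹ (minorProd C) =
      MvPolynomial.eval (fun i => (x i : ℂ)) (MvPolynomial.monomial (weight C.1) 1) •
        minorProd C := by
  apply Subtype.ext
  change translate (torus x)⁻¹ (∏ j, minor (D j) (C.1 j) (C.2 j).fst) =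
    _ • ∏ j, minor (D j) (C.1 j) (C.2 j).fst
  simp only [map_prod, eval_monomial_weight, translate_torus_inv_minor, Finset.prod_smul]

theorem IsDualCharacter.unique {φ ψ : MvPolynomial (Fin n) ℂ} (hφ : IsDualCharacter D φ)
    (hψ : IsDualCharacter D ψ) : φ = ψ :=
  eq_of_forall_eval_units fun x => (hφ x).trans (hψ x).symm

theorem exists_isDualCharacter_sum_monomial_weight (D : Fin n → Finset (Fin n)) :
    ∃ s : Finset (TuplesBelow D),
      IsDualCharacter D (∑ C ∈ s, MvPolynomial.monomial (weight C.1) 1) ∧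
      ∀ C : TuplesBelow D, ∃ C' ∈ s, weight C'.1 = weight C.1 := by
  have : Module.Finite ℂ (weylSubrep D).toSubmodule :=
    ⟨(Set.finite_range minorProd).toFinset, by simp [span_range_minorProd]⟩
  obtain ⟨s, htrace, hs⟩ := exists_finset_trace_eq_sum
    (weylModule_torus_inv_minorProd (D := D)) minorProd_ne_zero span_range_minorProd
  refine ⟨s, fun x => ?_, fun C => ?_⟩
  · rw [map_sum, dualCharacter_eq_trace_inv, htrace]
  · obtain ⟨C', hC', hweight⟩ := hs C
    exact ⟨C', hC', MvPolynomial.monomial_left_injective one_ne_zero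
      (eq_of_forall_eval_units (congrFun hweight))⟩

theorem exists_isDualCharacter_mem_support_iff (D : Fin n → Finset (Fin n)) :
    ∃ χ : MvPolynomial (Fin n) ℂ, IsDualCharacter D χ ∧
      (∀ m ∈ χ.support, ∃ c : ℕ, 0 < c ∧ χ.coeff m = (c : ℂ)) ∧
      ∀ m, m ∈ χ.support ↔ ∃ C : TuplesBelow D, weight C.1 = m := by
  obtain ⟨s, hs, hweight⟩ := exists_isDualCharacter_sum_monomial_weight D
  refine ⟨_, hs, fun m hm => ⟨_, ?_, coeff_sum_monomial_one s _ m⟩, fun m => ?_⟩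
  · rw [MvPolynomial.mem_support_iff, coeff_sum_monomial_one, Nat.cast_ne_zero] at hm
    exact Nat.pos_of_ne_zero hm
  · rw [mem_support_sum_monomial_one_iff]
    refine ⟨fun ⟨C, _, hC⟩ => ⟨C, hC⟩, ?_⟩
    rintro ⟨C, rfl⟩
    exact hweight C

end WeylModule

section NewtonPolytope

variable {n : ℕ}

theorem supportPoints_eq_image_basePolytope_sum_intRank {D : Fin n → Finset (Fin n)}
    {χ : MvPolynomial (Fin n) ℂ}
    (hχ : ∀ m, m ∈ χ.support ↔ ∃ C : TuplesBelow D, weight C.1 = m) :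
    supportPoints χ = (fun (p : Fin n → ℤ) i => (p i : ℝ)) ''
      basePolytope (∑ j, intRank (schubertMatroid (D j))) := by
  rw [basePolytope_sum (fun j _ => isSubmodular_intRank _) fun j _ => intRank_empty _]
  ext t
  constructor
  · rintro ⟨m, hm, rfl⟩
    obtain ⟨C, rfl⟩ := (hχ m).1 hm
    refine ⟨fun i => (weight C.1 i : ℤ), (Set.mem_fintype_sum _ _).2
      ⟨fun j i => if i ∈ C.1 j then 1 else 0, fun j => mem_basePolytope_intRank_iff.2
        ⟨C.1 j, schubertMatroid_isBase_iff.2 (C.2 j), rfl⟩, ?_⟩, ?_⟩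
    · ext i
      simp [weight_apply, Finset.sum_apply]
    · simp
  · rintro ⟨p, hp, rfl⟩
    obtain ⟨g, hg, rfl⟩ := (Set.mem_fintype_sum _ _).1 hp
    choose C hC hCg using fun j => mem_basePolytope_intRank_iff.1 (hg j)
    refine ⟨weight C, (hχ _).2
      ⟨⟨C, fun j => schubertMatroid_isBase_iff.1 (hC j)⟩, rfl⟩, funext fun i => ?_⟩
    simp [weight_apply, Finset.sum_apply, ← hCg]

variable {f : MvPolynomial (Fin n) ℂ} {F : Finset (Fin n) → ℤ}

theorem newtonPolytope_eq_basePolytope (hF : IsSubmodular F) (hF₀ : F ∅ = 0)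
    (hf : supportPoints f = (fun (p : Fin n → ℤ) i => (p i : ℝ)) '' basePolytope F) :
    newtonPolytope f = basePolytope fun I => (F I : ℝ) := by
  rw [newtonPolytope, hf, basePolytope_intCast_eq_convexHull hF hF₀]

theorem hasSNP_of_supportPoints_eq (hF : IsSubmodular F) (hF₀ : F ∅ = 0)
    (hf : supportPoints f = (fun (p : Fin n → ℤ) i => (p i : ℝ)) '' basePolytope F) :
    HasSNP f := fun p hp => by
  rw [newtonPolytope_eq_basePolytope hF hF₀ hf] at hp
  rw [hf]
  exact ⟨p, intCast_mem_basePolytope.1 hp, rfl⟩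

theorem basePolytope_sum_intRank_eq_sum_matroidPolytope {ι : Type*} [Fintype ι]
    (M : ι → Matroid (Fin n)) :
    basePolytope (fun I => (((∑ j, intRank (M j)) I : ℤ) : ℝ)) = ∑ j, matroidPolytope (M j) := by
  simp only [matroidPolytope_eq_basePolytope]
  rw [← basePolytope_sum (fun j _ => (isSubmodular_intRank (M j)).intCast)
    fun j _ => by rw [intRank_empty, Int.cast_zero]]
  congr 1
  ext I
  simp only [Finset.sum_apply, Int.cast_sum]

end NewtonPolytope

end FlaggedWeyl

end

open FlaggedWeyl

theorem mainTheorem1 (n : ℕ) (D : Fin n → Finset (Fin n)) :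
    ∃ χ : MvPolynomial (Fin n) ℂ,
      (∀ ψ : MvPolynomial (Fin n) ℂ, FlaggedWeyl.IsDualCharacter D ψ ↔ ψ = χ) ∧
      FlaggedWeyl.HasSNP χ ∧
      (∀ m ∈ χ.support, ∃ c : ℕ, 0 < c ∧ χ.coeff m = (c : ℂ)) ∧
      FlaggedWeyl.newtonPolytope χ =
        ∑ j : Fin n, FlaggedWeyl.matroidPolytope (FlaggedWeyl.schubertMatroid (D j)) ∧
      FlaggedWeyl.IsGeneralizedPermutahedron (FlaggedWeyl.newtonPolytope χ) := by
  obtain ⟨χ, hχ, hpos, hsupport⟩ := exists_isDualCharacter_mem_support_iff D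
  have hpoints := supportPoints_eq_image_basePolytope_sum_intRank hsupport
  set F := ∑ j, intRank (schubertMatroid (D j)) with hF_def
  have hF : IsSubmodular F := isSubmodular_sum fun j _ => isSubmodular_intRank _
  have hF₀ : F ∅ = 0 := by simp [hF_def, intRank_empty]
  have hnewton := newtonPolytope_eq_basePolytope hF hF₀ hpoints
  refine ⟨χ, fun ψ => ⟨fun hψ => hψ.unique hχ, fun hψ => hψ ▸ hχ⟩,
    hasSNP_of_supportPoints_eq hF hF₀ hpoints, hpos, ?_, ?_⟩
  · rw [hnewton, basePolytope_sum_intRank_eq_sum_matroidPolytope]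
  · rw [hnewton]
    exact isGeneralizedPermutahedron_basePolytope hF.intCast (by rw [hF₀, Int.cast_zero])
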